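/- **Games.** A stochastic 2-player game $\mathcal G=((V_1,V_2,V_p),E,\delta,s_0)$ consists of pairwise disjoint sets of nodes with union $V$, a set $E\subseteq (V_1\cup V_2)\times V$ of moves (written $q\to r$), a map $\delta$ from $V_p$ to the finitely supported probability distributions on $V$, and $s_0\in V_1$. A run is a nonempty finite word over $V$ that starts with $s_0$ and in which each node $q$ is followed by some $r$ with $q\to r$ (if $q\in V_1\cup V_2$) or with $\delta(q)(r)>0$ (if $q\in V_p$). A strategy of Player $i$ is a partial function $\phi$ from runs to finitely supported distributions on $V$, defined exactly on the runs that end in a node of $V_i$ having a successor, such that $wx$ is a run whenever $\phi(w)(x)>0$. The value of a run under $\phi_1,\phi_2$ is the product of the probabilities of its steps (given by $\phi_1$, $\phi_2$ or $\delta$ according to the owner of the current node). For $F\subseteq V_1$, $\mathrm{Reach}(\mathcal G[\phi_1,\phi_2],F)$ is the sum of the values of all runs whose last node, and no earlier node, lies in $F$. For $\kappa\in\{++,+-,-+,--\}$, $\mathrm{Reach}(\mathcal G,F)^{\kappa}$ is obtained by taking $\sup$ ($+$) or $\inf$ ($-$) over $\phi_1$ outermost (first sign), and $\sup$ or $\inf$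 over $\phi_2$ (second sign). For an MDP ($V_2=\emptyset$) Player 2 has only the empty strategy, and $\mathrm{Reach}^{+}$, $\mathrm{Reach}^-$ denote the $\sup$ and $\inf$ over $\phi_1$. **Programs.** Let $\mathcal V$ be a finite set of variables with ranges, and $\Sigma$ the set of configurations (maps assigning to each variable an element of its range). A transition is a map $f:2^\Sigma\to 2^\Sigma$ with $|f(\{\sigma\})|\le 1$ and $f(M)=\bigcup_{\sigma\in M}f(\{\sigma\})$; it is a guard if always $f(\{\sigma\})\in\{\{\sigma\},\emptyset\}$ ($\sigma$ enables $f$ if $f(\{\sigma\})=\{\sigma\}$), and an assignment if always $|f(\{\sigma\})|=1$, in which case $f(\{\sigma\})=\{[\![f]\!](\sigma)\}$. A nondeterministic probabilistic program $P$ consists of $\mathcal V$, an initial configuration $\sigma_0$ and a finite set $\mathcal C$ of guarded commands $A=(g_A\to p_1:c_1+\dots+p_m:c_m)$, $m\ge1$, with a guard $g_A$, probabilities $p_j$ summing to $1$, and assignments $c_j$. Its MDP $\mathcal M_P$ has $V_1=\Sigma$, $V_p=\Sigma\times\mathcal C$, start $\sigma_0$, moves $\sigma\to\langle\sigma,A\rangle$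 iff $\sigma$ enables $g_A$, and $\delta(\langle\sigma,A\rangle)(\sigma')=\sum_{j:\,[\![c_j]\!](\sigma)=\sigma'}p_j$. Let $F\subseteq\Sigma$ with $\sigma_0\notin F$, and assume that every run of $\mathcal M_P$ ending in a configuration ends in an element of $F$ or in a configuration enabling some guard. **Valid abstractions.** Let $D^\sharp$ be a complete lattice with maps $\alpha:2^\Sigma\to D^\sharp$, $\gamma:D^\sharp\to 2^\Sigma$ forming a Galois connection. A game $\mathcal G$ with finitely many nodes is a valid abstraction of $P$ relative to $F$ for $D^\sharp$ if: - $V_1$ consists of some elements of $D^\sharp$ and two further states $\varocircle,\varotimes$, which have no outgoing moves; $s_0=\alpha(\{\sigma_0\})$. Below, $s$ ranges over $V_1\setminus\{\varocircle,\varotimes\}$. - The elements of $V_2$ are pairs $\langle s,\varocircle\rangle$, or $\langle s,A\rangle$ with $A\in\mathcal C$ enabled by some state of $\gamma(s)$. - The elements of $V_p$ are tuples $\langle s,A,s',d\rangle$ where $s'\in D^\sharp$, $s'\sqsubseteq s$, $A\in\mathcal C$ is enabled by some state of $\gamma(s')$, and $d$ assigns to every update $\langle p_j,c_j\rangle$ of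 $A$ an abstract state $d_j\in V_1\cap D^\sharp$ with $c_j(\gamma(s'))\subseteq\gamma(d_j)$; moreover $\delta(\langle s,A,s',d\rangle)(s'')=\sum_{j:\,d_j=s''}p_j$. - The moves of Player 1 are exactly: $s\to\langle s,\varocircle\rangle$ if $\gamma(s)\cap F\neq\emptyset$; and $s\to\langle s,A\rangle$ if $g_A(\gamma(s))\ne\emptyset$ and $\gamma(s)\not\subseteq F$. - If $\gamma(s)\cap F\ne\emptyset$, then $\langle s,\varocircle\rangle\to\varocircle$; if in addition $\gamma(s)\subseteq F$, this is the only move from $\langle s,\varocircle\rangle$, and otherwise also $\langle s,\varocircle\rangle\to\langle s,\varocircle\rangle$. - For every $\langle s,A\rangle\in V_2$ with $A\in\mathcal C$: the sets $\gamma(s')$ of the successors $\langle s,A,s',d\rangle$ of $\langle s,A\rangle$ cover $g_A(\gamma(s))$; if $\gamma(s)\cap F\neq\emptyset$ then $\langle s,A\rangle\to\varocircle$; if $g_A(\gamma(s))\ne\gamma(s)$ then $\langle s,A\rangle\to\varotimes$. No disjointness of the sets $\gamma(s)$ is required. **Theorem.** If $\mathcal G$ is a valid abstraction of $P$ relative to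 $F$ for $D^\sharp$, then $$\mathrm{Reach}(\mathcal M_P,F)^{-}\in\big[\mathrm{Reach}(\mathcal G,\{\varocircle,\varotimes\})^{--},\ \mathrm{Reach}(\mathcal G,\{\varocircle,\varotimes\})^{-+}\big]$$ and $$\mathrm{Reach}(\mathcal M_P,F)^{+}\in\big[\mathrm{Reach}(\mathcal G,\{\varocircle\})^{+-},\ \mathrm{Reach}(\mathcal G,\{\varocircle\})^{++}\big].$$ -/

import Mathlib

open scoped ENNReal

universe u v w x

/-! ## Stochastic two-player games -/

/-- A stochastic 2-player game whose nodes are drawn from the type `N`. `V1`, `V2`, `Vp` are the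
nodes of Player 1, of Player 2 and the probabilistic nodes, `E` is the set of admissible player
choices and `s0` the start state. The distribution `δ v` has finite support; only its values at
nodes `v ∈ Vp` matter. -/
structure StochasticGame (N : Type u) where
  V1 : Set N
  V2 : Set N
  Vp : Set N
  disjoint12 : Disjoint V1 V2
  disjoint1p : Disjoint V1 Vp
  disjoint2p : Disjoint V2 Vp
  E : N → N → Prop
  E_source : ∀ {q r}, E q r → q ∈ V1 ∪ V2
  E_target : ∀ {q r}, E q r → r ∈ V1 ∪ V2 ∪ Vp
  δ : N → PMF N
  δ_target : ∀ q ∈ Vp, (δ q).support ⊆ V1 ∪ V2 ∪ Vp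
  δ_finite : ∀ q ∈ Vp, (δ q).support.Finite
  s0 : N
  s0_mem : s0 ∈ V1

namespace StochasticGame

variable {N : Type u}

/-- The set `V` of all nodes. -/
def V (G : StochasticGame N) : Set N := G.V1 ∪ G.V2 ∪ G.Vp

/-- Finite runs. A run `x₁ x₂ … xₖ` is represented by the list `[xₖ, …, x₂, x₁]`, that is, the
most recent node comes first. -/
inductive IsRun (G : StochasticGame N) : List N → Prop
  | start : IsRun G [G.s0]
  | player {w : List N} {s' s : N} :
      IsRun G (s' :: w) → s' ∈ G.V1 ∪ G.V2 → G.E s' s → IsRun G (s :: s' :: w)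
  | random {w : List N} {s' s : N} :
      IsRun G (s' :: w) → s' ∈ G.Vp → 0 < G.δ s' s → IsRun G (s :: s' :: w)

/-- A run is accepting relative to `F` if its last node is in `F` and no earlier node is. -/
def IsAccepting (G : StochasticGame N) (F : Set N) (w : List N) : Prop :=
  G.IsRun w ∧ ∃ (y : N) (w' : List N), w = y :: w' ∧ y ∈ F ∧ ∀ z ∈ w', z ∉ F

/-- Strategies of the player who owns the set `U` of nodes (`U = V1` or `U = V2`): partial
functions from runs to distributions of finite support, defined exactly on the runs that end in a
node of `U` that has a successor, and choosing only moves that prolong the run to a run. -/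
structure Strategy (G : StochasticGame N) (U : Set N) where
  choice : List N → Option (PMF N)
  defined_iff : ∀ w, (choice w).isSome ↔
    G.IsRun w ∧ ∃ (y : N) (w' : List N), w = y :: w' ∧ y ∈ U ∧ ∃ z, G.E y z
  finite_support : ∀ w μ, choice w = some μ → μ.support.Finite
  admissible : ∀ w μ, choice w = some μ → ∀ z, 0 < μ z → G.IsRun (z :: w)

/-- The probability `φ(w)(z)`, taken to be `0` if `φ(w)` is undefined. -/
noncomputable def Strategy.prob {G : StochasticGame N} {U : Set N} (φ : G.Strategy U)
    (w : List N) (z : N) : ℝ≥0∞ :=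
  match φ.choice w with
  | some μ => μ z
  | none => 0

open Classical in
/-- The value of a run under a pair of strategies. -/
noncomputable def val (G : StochasticGame N) (φ₁ : G.Strategy G.V1) (φ₂ : G.Strategy G.V2) :
    List N → ℝ≥0∞
  | [] => 0
  | [s] => if s = G.s0 then 1 else 0
  | s :: s' :: w =>
      val G φ₁ φ₂ (s' :: w) *
        (if s' ∈ G.V1 then φ₁.prob (s' :: w) s
         else if s' ∈ G.V2 then φ₂.prob (s' :: w) s
         else if s' ∈ G.Vp then G.δ s' s
         else 0)

/-- The probability of reaching `F` under a pair of strategies. -/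
noncomputable def reach (G : StochasticGame N) (φ₁ : G.Strategy G.V1) (φ₂ : G.Strategy G.V2)
    (F : Set N) : ℝ≥0∞ :=
  ∑' r : {r : List N // G.IsAccepting F r}, G.val φ₁ φ₂ r.1

/-- The extremal game value `++`. -/
noncomputable def reachPP (G : StochasticGame N) (F : Set N) : ℝ≥0∞ :=
  ⨆ φ₁ : G.Strategy G.V1, ⨆ φ₂ : G.Strategy G.V2, G.reach φ₁ φ₂ F

/-- The extremal game value `+-`. -/
noncomputable def reachPM (G : StochasticGame N) (F : Set N) : ℝ≥0∞ :=
  ⨆ φ₁ : G.Strategy G.V1, ⨅ φ₂ : G.Strategy G.V2, G.reach φ₁ φ₂ F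

/-- The extremal game value `-+`. -/
noncomputable def reachMP (G : StochasticGame N) (F : Set N) : ℝ≥0∞ :=
  ⨅ φ₁ : G.Strategy G.V1, ⨆ φ₂ : G.Strategy G.V2, G.reach φ₁ φ₂ F

/-- The extremal game value `--`. -/
noncomputable def reachMM (G : StochasticGame N) (F : Set N) : ℝ≥0∞ :=
  ⨅ φ₁ : G.Strategy G.V1, ⨅ φ₂ : G.Strategy G.V2, G.reach φ₁ φ₂ F

end StochasticGame

/-! ## Nondeterministic probabilistic programs -/

/-- Configurations: maps that assign to every variable a value in its range. -/
abbrev Config {𝒱 : Type u} (rng : 𝒱 → Type v) : Type (max u v) := (y : 𝒱) → rng y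

/-- A transition maps singletons to singletons or the empty set, and is determined by its values
on singletons. -/
structure Transition (S : Type u) where
  toFun : Set S → Set S
  subsingleton : ∀ σ, (toFun {σ}).Subsingleton
  iUnion_eq : ∀ M, ⋃ σ ∈ M, toFun {σ} = toFun M

namespace Transition

variable {S : Type u}

instance : CoeFun (Transition S) (fun _ => Set S → Set S) := ⟨Transition.toFun⟩

def IsGuard (g : Transition S) : Prop := ∀ σ, g {σ} = {σ} ∨ g {σ} = ∅

/-- The configuration `σ` enables the guard `g`. -/
def Enables (σ : S) (g : Transition S) : Prop := g {σ} = {σ}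

def IsAssignment (c : Transition S) : Prop := ∀ σ, ∃ σ', c {σ} = {σ'}

/-- The semantics `⟦c⟧ : S → S` of an assignment. -/
noncomputable def IsAssignment.sem {c : Transition S} (hc : c.IsAssignment) (σ : S) : S :=
  (hc σ).choose

theorem IsAssignment.sem_spec {c : Transition S} (hc : c.IsAssignment) (σ : S) :
    c {σ} = {hc.sem σ} :=
  (hc σ).choose_spec

end Transition

/-- A guarded command `g → p₁ : c₁ + … + pₘ : cₘ`. The probabilities `p₁, …, pₘ`, which add up
to `1`, form a probability mass function on `Fin m` (so that `m ≥ 1`). -/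
structure GuardedCommand (S : Type u) where
  guard : Transition S
  isGuard : guard.IsGuard
  m : ℕ
  p : PMF (Fin m)
  c : Fin m → Transition S
  isAssignment : ∀ j, (c j).IsAssignment

/-- A nondeterministic probabilistic program over the variables `𝒱` with ranges `rng`, whose
guarded commands are named by the elements of `ι`. -/
structure NPP {𝒱 : Type u} (rng : 𝒱 → Type v) (ι : Type w) where
  σ0 : Config rng
  cmd : ι → GuardedCommand (Config rng)

namespace NPP

variable {𝒱 : Type u} {rng : 𝒱 → Type v} {ι : Type w}

/-- The Markov decision process of a program, as a game without nodes of Player 2: `Sum.inl σ` is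
the Player 1 node `σ` and `Sum.inr (σ, A)` is the probabilistic node `⟨σ, A⟩`. -/
noncomputable def mdp (P : NPP rng ι) : StochasticGame (Config rng ⊕ Config rng × ι) where
  V1 := Set.range Sum.inl
  V2 := ∅
  Vp := Set.range Sum.inr
  disjoint12 := Set.disjoint_empty _
  disjoint1p := by
    rw [Set.disjoint_left]
    rintro _ ⟨a, rfl⟩ ⟨b, hb⟩
    cases hb
  disjoint2p := Set.empty_disjoint _
  E := fun q r => ∃ (σ : Config rng) (A : ι),
    q = Sum.inl σ ∧ r = Sum.inr (σ, A) ∧ Transition.Enables σ (P.cmd A).guard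
  E_source := by
    rintro _ _ ⟨σ, A, rfl, rfl, _⟩
    simp
  E_target := by
    rintro _ _ ⟨σ, A, rfl, rfl, _⟩
    simp
  δ := fun q =>
    match q with
    | Sum.inl σ => PMF.pure (Sum.inl σ)
    | Sum.inr (σ, A) =>
        (P.cmd A).p.map (fun j => Sum.inl (((P.cmd A).isAssignment j).sem σ))
  δ_target := by
    rintro _ ⟨⟨σ, A⟩, rfl⟩ y hy
    rw [PMF.support_map] at hy
    obtain ⟨j, -, rfl⟩ := hy
    simp
  δ_finite := by
    rintro _ ⟨⟨σ, A⟩, rfl⟩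
    rw [PMF.support_map]
    exact (Set.toFinite _).image _
  s0 := Sum.inl P.σ0
  s0_mem := ⟨P.σ0, rfl⟩

/-- The maximal probability of reaching `F` in the Markov decision process of `P`. Player 2 has
exactly one strategy there, the empty one. -/
noncomputable def maxReach (P : NPP rng ι) (F : Set (Config rng)) : ℝ≥0∞ :=
  P.mdp.reachPP (Sum.inl '' F)

/-- The minimal probability of reaching `F` in the Markov decision process of `P`. -/
noncomputable def minReach (P : NPP rng ι) (F : Set (Config rng)) : ℝ≥0∞ :=
  P.mdp.reachMM (Sum.inl '' F)

/-- The computation does not get stuck: every run of the Markov decision process that ends in a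
configuration ends in a final one or in one that enables some guard. -/
def NeverStuck (P : NPP rng ι) (F : Set (Config rng)) : Prop :=
  ∀ (r : List (Config rng ⊕ Config rng × ι)) (σ : Config rng), P.mdp.IsRun (Sum.inl σ :: r) →
    σ ∈ F ∨ ∃ A, Transition.Enables σ (P.cmd A).guard

end NPP

/-! ## Valid abstractions -/

/-- The possible nodes of an abstraction of `P` over the abstract domain `D`: abstract states, the
distinguished states `○` and `⊗`, the pairs `⟨s, ○⟩` and `⟨s, A⟩`, and the tuples
`⟨s, A, s', d⟩`, where `d` assigns an abstract state to every update of `A`. -/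
inductive AbsNode {𝒱 : Type u} {rng : 𝒱 → Type v} {ι : Type w} (P : NPP rng ι) (D : Type x) :
    Type (max w x)
  | state (s : D) : AbsNode P D
  | circle : AbsNode P D
  | cross : AbsNode P D
  | proposeEnd (s : D) : AbsNode P D
  | propose (s : D) (A : ι) : AbsNode P D
  | resolve (s : D) (A : ι) (s' : D) (d : Fin (P.cmd A).m → D) : AbsNode P D

open AbsNode in
/-- The game `G` is a valid abstraction of `P` relative to `F` for the abstract domain `D` with
abstraction map `α` and concretization map `γ`. -/
structure IsValidAbstraction {𝒱 : Type u} {rng : 𝒱 → Type v} {ι : Type w} {D : Type x}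
    [CompleteLattice D] (P : NPP rng ι) (F : Set (Config rng))
    (α : Set (Config rng) → D) (γ : D → Set (Config rng))
    (G : StochasticGame (AbsNode P D)) : Prop where
  finite : G.V.Finite
  /-- The nodes of Player 1 are abstract states, `○` and `⊗`. -/
  V1_form : ∀ n ∈ G.V1, n = circle ∨ n = cross ∨ ∃ s, n = state s
  circle_mem : circle ∈ G.V1
  cross_mem : cross ∈ G.V1
  V2_form : ∀ n ∈ G.V2,
    (∃ s, n = proposeEnd s ∧ state s ∈ G.V1) ∨
    (∃ s A, n = propose s A ∧ state s ∈ G.V1 ∧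
      ∃ σ ∈ γ s, Transition.Enables σ (P.cmd A).guard)
  Vp_form : ∀ n ∈ G.Vp, ∃ s A s' d, n = resolve s A s' d ∧ state s ∈ G.V1 ∧ s' ≤ s ∧
    (∃ σ ∈ γ s', Transition.Enables σ (P.cmd A).guard) ∧
    ∀ j, state (d j) ∈ G.V1 ∧ (P.cmd A).c j (γ s') ⊆ γ (d j)
  start_eq : G.s0 = state (α {P.σ0})
  /-- From `s`, Player 1 can propose to end the play iff `γ s` contains a final state. -/
  state_end_iff : ∀ s, state s ∈ G.V1 →
    (G.E (state s) (proposeEnd s) ↔ (γ s ∩ F).Nonempty)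
  /-- From `s`, Player 1 can propose `A` iff some state of `γ s` enables `A`, except if all states
  of `γ s` are final. -/
  state_propose_iff : ∀ s A, state s ∈ G.V1 →
    (G.E (state s) (propose s A) ↔ ((P.cmd A).guard (γ s)).Nonempty ∧ ¬ γ s ⊆ F)
  /-- Player 1 has no other moves from `s`. -/
  state_succ : ∀ s n, state s ∈ G.V1 → G.E (state s) n → n = proposeEnd s ∨ ∃ A, n = propose s A
  /-- Player 2 can accept the proposal to end the play. -/
  end_accept : ∀ s, state s ∈ G.V1 → (γ s ∩ F).Nonempty → G.E (proposeEnd s) circle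
  /-- Player 2 has to accept it if all states of `γ s` are final. -/
  end_only : ∀ s, state s ∈ G.V1 → (γ s ∩ F).Nonempty → γ s ⊆ F →
    ∀ n, G.E (proposeEnd s) n → n = circle
  /-- Player 2 can reject it, by staying, if some state of `γ s` is not final. -/
  end_reject : ∀ s, state s ∈ G.V1 → (γ s ∩ F).Nonempty → ¬ γ s ⊆ F →
    G.E (proposeEnd s) (proposeEnd s)
  /-- Player 2 can accept `A` and choose `⟨s, A, s', d⟩`; the sets `γ s'` of these (finitely many)
  choices cover the states of `γ s` that enable `A`. -/
  propose_accept : ∀ s A, propose s A ∈ G.V2 →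
    (P.cmd A).guard (γ s) ⊆ ⋃ s' ∈ {s' | ∃ d, G.E (propose s A) (resolve s A s' d)}, γ s'
  propose_circle : ∀ s A, propose s A ∈ G.V2 → (γ s ∩ F).Nonempty → G.E (propose s A) circle
  propose_cross : ∀ s A, propose s A ∈ G.V2 → (P.cmd A).guard (γ s) ≠ γ s →
    G.E (propose s A) cross
  δ_eq : ∀ s A s' d, resolve s A s' d ∈ G.Vp →
    G.δ (resolve s A s' d) = (P.cmd A).p.map (fun j => state (d j))
  circle_dead : ∀ n, ¬ G.E circle n
  cross_dead : ∀ n, ¬ G.E cross n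

/-!
Since there are finitely many moves at each node and the distributions have finite support, each of
the four extremal reachability probabilities is the limit of value iteration from `0` with a Bellman
operator: a minimizer plays optimally for the limit, a maximizer optimally for the iterate given by
the number of steps left.

It therefore suffices to compare the iterates for the program at `σ` with those for the abstraction
at any `s` with `σ ∈ γ s`. Player 2 can simulate the program from `σ`: he answers a command `A` that
`σ` enables by some `⟨s, A, s', d⟩` with `σ ∈ γ s'`, so that the random update keeps the
configuration inside the abstract state. A proposal that is not available at `σ` he answers to the
disadvantage of Player 1: by `⊗`, by staying at `⟨s, ○⟩`, or by `○`, depending on the target and the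
objectives.
-/

theorem tsum_list_eq_add_tsum_cons {N : Type*} (g : List N → ℝ≥0∞) :
    ∑' w, g w = g [] + ∑' (w : List N) (z : N), g (z :: w) := by
  have cons_injective : Function.Injective fun p : List N × N => p.2 :: p.1 := by
    rintro ⟨w, z⟩ ⟨w', z'⟩ h
    simpa [and_comm] using h
  rw [ENNReal.tsum_eq_add_tsum_ite [], ← ENNReal.tsum_prod, ← cons_injective.tsum_eq]
  · exact congrArg _ (tsum_congr fun _ => if_neg (List.cons_ne_nil _ _))
  · rintro (_ | ⟨z, w⟩) hw
    · simp at hw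
    · exact ⟨(w, z), rfl⟩

theorem tsum_pmf_map_mul {β N : Type*} (p : PMF β) (f : β → N) (W : N → ℝ≥0∞) :
    ∑' z, p.map f z * W z = ∑' b, p b * W (f b) := by
  classical
  simp only [PMF.map_apply, ← ENNReal.tsum_mul_right]
  rw [ENNReal.tsum_comm]
  refine tsum_congr fun b => ?_
  rw [tsum_eq_single (f b) fun z hz => by rw [if_neg hz, zero_mul], if_pos rfl]

theorem tsum_mul_iSup_of_monotone {N : Type*} {p : PMF N} (hp : p.support.Finite)
    {v : ℕ → N → ℝ≥0∞} (hv : Monotone v) :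
    ∑' z, p z * ⨆ n, v n z = ⨆ n, ∑' z, p z * v n z := by
  have tsum_eq_sum_support (W : N → ℝ≥0∞) :
      ∑' z, p z * W z = ∑ z ∈ hp.toFinset, p z * W z :=
    tsum_eq_sum fun z hz => by
      rw [(p.apply_eq_zero_iff z).2 (by simpa using hz), zero_mul]
  rw [tsum_eq_sum_support fun z => ⨆ n, v n z]
  simp only [tsum_eq_sum_support, ENNReal.mul_iSup]
  exact ENNReal.finsetSum_iSup_of_monotone fun z _ _ h => mul_le_mul_right (hv h z) _

/-- The aim of a player in value iteration: to minimize or to maximize the reachability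
probability. -/
inductive Objective
  | min
  | max

namespace Objective

variable {N : Type*} {o : Objective} {S : Set N} {V W : N → ℝ≥0∞}

open Classical in
/-- The best value of `W` on a set `S` of options. Without options it is `0` for both objectives,
since a run that ends in a dead end never reaches the target. -/
noncomputable def best : Objective → Set N → (N → ℝ≥0∞) → ℝ≥0∞
  | min, S, W => if S.Nonempty then ⨅ z ∈ S, W z else 0
  | max, S, W => ⨆ z ∈ S, W z

theorem best_empty (o : Objective) (W : N → ℝ≥0∞) : o.best ∅ W = 0 := by
  cases o <;> simp [best]

theorem best_min_le {z : N} (hz : z ∈ S) : min.best S W ≤ W z := by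
  rw [best, if_pos ⟨z, hz⟩]
  exact iInf₂_le z hz

theorem le_best_min {c : ℝ≥0∞} (hS : S.Nonempty) (h : ∀ z ∈ S, c ≤ W z) : c ≤ min.best S W := by
  rw [best, if_pos hS]
  exact le_iInf₂ h

theorem le_best_max {z : N} (hz : z ∈ S) : W z ≤ max.best S W :=
  le_iSup₂_of_le z hz le_rfl

theorem best_max_le {c : ℝ≥0∞} (h : ∀ z ∈ S, W z ≤ c) : max.best S W ≤ c :=
  iSup₂_le h

theorem exists_eq_best (hS : S.Finite) (hne : S.Nonempty) (o : Objective) (W : N → ℝ≥0∞) :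
    ∃ z ∈ S, W z = o.best S W := by
  cases o with
  | min =>
    obtain ⟨z, hz, hmin⟩ := Set.exists_min_image S W hS hne
    exact ⟨z, hz, (le_best_min hne hmin).antisymm (best_min_le hz)⟩
  | max =>
    obtain ⟨z, hz, hmax⟩ := Set.exists_max_image S W hS hne
    exact ⟨z, hz, (le_best_max hz).antisymm (best_max_le hmax)⟩

theorem best_mono (h : V ≤ W) : o.best S V ≤ o.best S W := by
  cases o with
  | min =>
    rw [best, best]
    split_ifs
    · exact iInf₂_mono fun z _ => h z
    · exact le_rfl
  | max => exact iSup₂_mono fun z _ => h z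

theorem best_le_one (h : ∀ z, W z ≤ 1) : o.best S W ≤ 1 := by
  rcases S.eq_empty_or_nonempty with rfl | ⟨z, hz⟩
  · exact (o.best_empty W).trans_le zero_le_one
  · cases o with
    | min => exact (best_min_le hz).trans (h z)
    | max => exact best_max_le fun z _ => h z

theorem best_iSup (hS : S.Finite) {v : ℕ → N → ℝ≥0∞} (hv : Monotone v) :
    o.best S (fun z => ⨆ n, v n z) = ⨆ n, o.best S (v n) := by
  cases o with
  | min =>
    simp only [best]
    split_ifs
    · exact (hS.iSup_biInf_of_monotone fun z _ _ _ h => hv h z).symm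
    · simp
  | max =>
    simp only [best]
    rw [iSup_comm]
    exact iSup_congr fun z => iSup_comm

end Objective

namespace StochasticGame

variable {N : Type*} {G : StochasticGame N}

section Reach

open Classical in
/-- The probability of prolonging the run `w` by the node `z`: the factor by which `val` grows in
that step. -/
noncomputable def transProb (φ₁ : G.Strategy G.V1) (φ₂ : G.Strategy G.V2) : List N → N → ℝ≥0∞
  | [], _ => 0
  | q :: w, z =>
      if q ∈ G.V1 then φ₁.prob (q :: w) z
      else if q ∈ G.V2 then φ₂.prob (q :: w) z
      else if q ∈ G.Vp then G.δ q z
      else 0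

variable (φ₁ : G.Strategy G.V1) (φ₂ : G.Strategy G.V2) (T : Set N)

theorem val_cons_cons (z q : N) (w : List N) :
    G.val φ₁ φ₂ (z :: q :: w) = G.val φ₁ φ₂ (q :: w) * transProb φ₁ φ₂ (q :: w) z := by
  rw [val, transProb]

theorem Strategy.isRun_of_prob_ne_zero {U : Set N} (φ : G.Strategy U) {w : List N} {z : N}
    (h : φ.prob w z ≠ 0) : G.IsRun (z :: w) := by
  unfold Strategy.prob at h
  split at h
  · next μ hμ => exact φ.admissible w μ hμ z (pos_iff_ne_zero.2 h)
  · exact absurd rfl h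

variable {φ₁ φ₂} in
theorem isRun_of_transProb_ne_zero {q z : N} {w : List N} (hw : G.IsRun (q :: w))
    (h : transProb φ₁ φ₂ (q :: w) z ≠ 0) : G.IsRun (z :: q :: w) := by
  rw [transProb] at h
  split_ifs at h with _ _ hq
  · exact φ₁.isRun_of_prob_ne_zero h
  · exact φ₂.isRun_of_prob_ne_zero h
  · exact .random hw hq (pos_iff_ne_zero.2 h)
  · exact absurd rfl h

variable {φ₁ φ₂} in
theorem isRun_of_val_ne_zero : ∀ {w : List N}, G.val φ₁ φ₂ w ≠ 0 → G.IsRun w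
  | [], h => absurd rfl h
  | [q], h => by
    obtain rfl : q = G.s0 := by
      by_contra hq
      simp [val, hq] at h
    exact .start
  | z :: q :: w, h => by
    rw [val_cons_cons] at h
    exact isRun_of_transProb_ne_zero (isRun_of_val_ne_zero (left_ne_zero_of_mul h))
      (right_ne_zero_of_mul h)

/-- The nonempty words whose last node is in `T`. -/
def endsIn : Set (List N) := {w | ∃ q ∈ w.head?, q ∈ T}

variable {T} in
theorem cons_mem_endsIn {q : N} {w : List N} : q :: w ∈ endsIn T ↔ q ∈ T := by
  simp [endsIn]

/-- The words of `k + 1` nodes that avoid `T` before their last node. -/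
def level (k : ℕ) : Set (List N) := {w | w.length = k + 1 ∧ ∀ z ∈ w.tail, z ∉ T}

theorem cons_cons_mem_level_succ {z q : N} {w : List N} {k : ℕ} :
    z :: q :: w ∈ level T (k + 1) ↔ q :: w ∈ level T k ∧ q ∉ T := by
  simp only [level, Set.mem_ofPred_eq, List.length_cons, List.tail_cons, List.forall_mem_cons,
    Nat.add_right_cancel_iff]
  tauto

/-- The expectation of `f` after `k` steps, restricted to the runs that have not visited `T`
before. -/
noncomputable def levelSum (k : ℕ) (f : List N → ℝ≥0∞) : ℝ≥0∞ :=
  ∑' w, (level T k).indicator (fun w => G.val φ₁ φ₂ w * f w) w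

/-- The expectation of `f` after one more step, unless `T` has been reached. -/
noncomputable def stepExp (f : List N → ℝ≥0∞) : List N → ℝ≥0∞ :=
  (endsIn T)ᶜ.indicator fun w => ∑' z, transProb φ₁ φ₂ w z * f (z :: w)

/-- The probability of reaching `T` in fewer than `n` further steps, given the run so far. -/
noncomputable def reachWithin : ℕ → List N → ℝ≥0∞
  | 0 => 0
  | n + 1 => (endsIn T).indicator 1 + stepExp φ₁ φ₂ T (reachWithin n)

theorem levelSum_zero (f : List N → ℝ≥0∞) : levelSum φ₁ φ₂ T 0 f = f [G.s0] := by
  rw [levelSum, tsum_eq_single [G.s0], Set.indicator_of_mem (by simp [level])]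
  · simp [val]
  · intro w hw
    match w with
    | [] => simp [val]
    | [q] => simp [val, show q ≠ G.s0 from fun h => hw (by rw [h])]
    | q :: r :: w => simp [level]

theorem levelSum_succ (k : ℕ) (f : List N → ℝ≥0∞) :
    levelSum φ₁ φ₂ T (k + 1) f = levelSum φ₁ φ₂ T k (stepExp φ₁ φ₂ T f) := by
  rw [levelSum, tsum_list_eq_add_tsum_cons, Set.indicator_of_notMem (by simp [level]), zero_add]
  refine tsum_congr fun w => ?_
  cases w with
  | nil => simp [level]
  | cons q w =>
    by_cases hw : q :: w ∈ level T k <;> by_cases hq : q ∈ T <;>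
      simp [Set.indicator, cons_cons_mem_level_succ, hw, hq, stepExp, cons_mem_endsIn,
        val_cons_cons, mul_assoc, ENNReal.tsum_mul_left]

theorem levelSum_add (k : ℕ) (f g : List N → ℝ≥0∞) :
    levelSum φ₁ φ₂ T k (f + g) = levelSum φ₁ φ₂ T k f + levelSum φ₁ φ₂ T k g := by
  unfold levelSum
  rw [← ENNReal.tsum_add]
  refine tsum_congr fun w => ?_
  by_cases hw : w ∈ level T k <;> simp [Set.indicator, hw, mul_add]

theorem levelSum_reachWithin (n k : ℕ) :
    levelSum φ₁ φ₂ T k (reachWithin φ₁ φ₂ T n) =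
      ∑ i ∈ Finset.range n, levelSum φ₁ φ₂ T (k + i) ((endsIn T).indicator 1) := by
  induction n generalizing k with
  | zero => simp [reachWithin, levelSum]
  | succ n ih =>
    rw [reachWithin, levelSum_add, ← levelSum_succ, ih, Finset.sum_range_succ', add_comm]
    simp only [add_assoc, add_comm 1, add_zero]

theorem isAccepting_iff {k : ℕ} {w : List N} (hw : G.IsRun w) (hk : w.length = k + 1) :
    G.IsAccepting T w ↔ w ∈ level T k ∩ endsIn T := by
  cases w with
  | nil => simp at hk
  | cons q w =>
    simp only [IsAccepting, hw, level, hk, Set.mem_inter_iff, Set.mem_ofPred_eq, cons_mem_endsIn,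
      List.tail_cons, true_and, List.cons.injEq]
    exact ⟨fun ⟨_, _, ⟨rfl, rfl⟩, hq, h⟩ => ⟨h, hq⟩, fun ⟨h, hq⟩ => ⟨q, w, ⟨rfl, rfl⟩, hq, h⟩⟩

theorem reach_eq_tsum_levelSum :
    G.reach φ₁ φ₂ T = ∑' k, levelSum φ₁ φ₂ T k ((endsIn T).indicator 1) := by
  unfold levelSum reach
  rw [ENNReal.tsum_comm]
  refine (tsum_subtype {w | G.IsAccepting T w} (G.val φ₁ φ₂)).trans (tsum_congr fun w => ?_)
  by_cases hval : G.val φ₁ φ₂ w = 0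
  · simp [Set.indicator, hval]
  have hrun := isRun_of_val_ne_zero hval
  obtain ⟨k, hk⟩ : ∃ k, w.length = k + 1 := by
    cases hrun <;> exact ⟨_, rfl⟩
  rw [tsum_eq_single k fun l hl => Set.indicator_of_notMem
    (fun hw => hl (Nat.succ_injective (hw.1.symm.trans hk))) _]
  by_cases hw : w ∈ level T k <;> by_cases hT : w ∈ endsIn T <;>
    simp [Set.indicator, isAccepting_iff T hrun hk, hw, hT]

theorem reach_eq_iSup_reachWithin : G.reach φ₁ φ₂ T = ⨆ n, reachWithin φ₁ φ₂ T n [G.s0] := by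
  rw [reach_eq_tsum_levelSum, ENNReal.tsum_eq_iSup_nat]
  refine iSup_congr fun n => ?_
  rw [← levelSum_zero φ₁ φ₂ T (reachWithin φ₁ φ₂ T n), levelSum_reachWithin]
  simp only [zero_add]

variable {T} in
theorem reachWithin_succ_of_mem {q : N} (hq : q ∈ T) (n : ℕ) (w : List N) :
    reachWithin φ₁ φ₂ T (n + 1) (q :: w) = 1 := by
  simp [reachWithin, stepExp, cons_mem_endsIn, hq]

variable {T} in
theorem reachWithin_succ_of_notMem {q : N} (hq : q ∉ T) (n : ℕ) (w : List N) :
    reachWithin φ₁ φ₂ T (n + 1) (q :: w) =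
      ∑' z, transProb φ₁ φ₂ (q :: w) z * reachWithin φ₁ φ₂ T n (z :: q :: w) := by
  simp [reachWithin, stepExp, cons_mem_endsIn, hq]

end Reach

section Strategies

variable {U : Set N} {o : Objective}

/-- Every node has only finitely many successors among the moves of the players. -/
def FinitelyBranching (G : StochasticGame N) : Prop := ∀ q, {z | G.E q z}.Finite

theorem edge_of_isRun {q z : N} {w : List N} (hq : q ∈ G.V1 ∪ G.V2) (h : G.IsRun (z :: q :: w)) :
    G.E q z := by
  cases h with
  | player _ _ h => exact h
  | random _ h _ =>
    rcases hq with hq | hq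
    · exact absurd h (G.disjoint1p.notMem_of_mem_left hq)
    · exact absurd h (G.disjoint2p.notMem_of_mem_left hq)

namespace Strategy

theorem edge_of_prob_ne_zero (φ : G.Strategy U) (hU : U ⊆ G.V1 ∪ G.V2) {q z : N} {w : List N}
    (hq : q ∈ U) (h : φ.prob (q :: w) z ≠ 0) : G.E q z :=
  edge_of_isRun (hU hq) (φ.isRun_of_prob_ne_zero h)

theorem tsum_prob_le_one (φ : G.Strategy U) (w : List N) : ∑' z, φ.prob w z ≤ 1 := by
  unfold prob
  split
  · next μ _ => exact μ.tsum_coe.le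
  · simp

theorem tsum_prob (φ : G.Strategy U) {q : N} {w : List N} (hw : G.IsRun (q :: w)) (hq : q ∈ U)
    (h : ∃ z, G.E q z) : ∑' z, φ.prob (q :: w) z = 1 := by
  obtain ⟨μ, hμ⟩ := Option.isSome_iff_exists.1 ((φ.defined_iff (q :: w)).2 ⟨hw, q, w, rfl, hq, h⟩)
  simp only [prob, hμ]
  exact μ.tsum_coe

theorem tsum_prob_mul_eq_zero (φ : G.Strategy U) (hU : U ⊆ G.V1 ∪ G.V2) {q : N} (hq : q ∈ U)
    (h : ¬ ∃ z, G.E q z) (w : List N) (W : N → ℝ≥0∞) : ∑' z, φ.prob (q :: w) z * W z = 0 :=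
  ENNReal.tsum_eq_zero.2 fun z => mul_eq_zero_of_left
    (by_contra fun hz => h ⟨z, φ.edge_of_prob_ne_zero hU hq hz⟩) _

/-- The moves of `φ` have an expected reward of at most the best one for the objective `o`. The
reward `W w z` of a move from the run `w` to the node `z` may depend on the whole run. -/
def GuaranteesLE (φ : G.Strategy U) (o : Objective) (W : List N → N → ℝ≥0∞) : Prop :=
  ∀ q w, G.IsRun (q :: w) → q ∈ U →
    ∑' z, φ.prob (q :: w) z * W (q :: w) z ≤ o.best {z | G.E q z} (W (q :: w))

/-- The moves of `φ` have an expected reward of at least the best one for the objective `o`. -/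
def GuaranteesGE (φ : G.Strategy U) (o : Objective) (W : List N → N → ℝ≥0∞) : Prop :=
  ∀ q w, G.IsRun (q :: w) → q ∈ U →
    o.best {z | G.E q z} (W (q :: w)) ≤ ∑' z, φ.prob (q :: w) z * W (q :: w) z

theorem guaranteesLE_max (φ : G.Strategy U) (hU : U ⊆ G.V1 ∪ G.V2) (W : List N → N → ℝ≥0∞) :
    φ.GuaranteesLE .max W := by
  intro q w _ hq
  set b := Objective.max.best {z | G.E q z} (W (q :: w))
  calc ∑' z, φ.prob (q :: w) z * W (q :: w) z
      ≤ ∑' z, φ.prob (q :: w) z * b := by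
        refine ENNReal.tsum_le_tsum fun z => ?_
        by_cases hz : φ.prob (q :: w) z = 0
        · simp [hz]
        · exact mul_le_mul_right (Objective.le_best_max (φ.edge_of_prob_ne_zero hU hq hz)) _
    _ = (∑' z, φ.prob (q :: w) z) * b := ENNReal.tsum_mul_right
    _ ≤ b := mul_le_of_le_one_left' (φ.tsum_prob_le_one _)

theorem guaranteesGE_min (φ : G.Strategy U) (hU : U ⊆ G.V1 ∪ G.V2) (W : List N → N → ℝ≥0∞) :
    φ.GuaranteesGE .min W := by
  intro q w hw hq
  set b := Objective.min.best {z | G.E q z} (W (q :: w)) with hb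
  by_cases h : ∃ z, G.E q z
  · calc b = (∑' z, φ.prob (q :: w) z) * b := by rw [φ.tsum_prob hw hq h, one_mul]
      _ = ∑' z, φ.prob (q :: w) z * b := ENNReal.tsum_mul_right.symm
      _ ≤ ∑' z, φ.prob (q :: w) z * W (q :: w) z := by
        refine ENNReal.tsum_le_tsum fun z => ?_
        by_cases hz : φ.prob (q :: w) z = 0
        · simp [hz]
        · exact mul_le_mul_right (Objective.best_min_le (φ.edge_of_prob_ne_zero hU hq hz)) _
  · rw [hb, show {z | G.E q z} = ∅ from Set.not_nonempty_iff_eq_empty.1 h, Objective.best_empty]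
    exact zero_le

open Classical in
/-- The pure strategy that prolongs a run `w` by the node `f w`. -/
noncomputable def pure (hU : U ⊆ G.V1 ∪ G.V2) (f : List N → N)
    (hf : ∀ q w, q ∈ U → (∃ z, G.E q z) → G.E q (f (q :: w))) : G.Strategy U where
  choice w :=
    if G.IsRun w ∧ ∃ y w', w = y :: w' ∧ y ∈ U ∧ ∃ z, G.E y z then some (PMF.pure (f w)) else none
  defined_iff w := by
    split_ifs with h <;> simpa using h
  finite_support w μ h := by
    split_ifs at h
    cases h
    simp
  admissible w μ h z hz := by
    split_ifs at h with hw
    obtain ⟨hrun, q, w, rfl, hq, hsucc⟩ := hw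
    cases h
    obtain rfl : z = f (q :: w) := (PMF.mem_support_pure_iff _ _).1 hz.ne'
    exact .player hrun (hU hq) (hf q w hq hsucc)

theorem tsum_prob_pure_mul (hU : U ⊆ G.V1 ∪ G.V2) (f : List N → N)
    (hf : ∀ q w, q ∈ U → (∃ z, G.E q z) → G.E q (f (q :: w))) {q : N} {w : List N}
    (hw : G.IsRun (q :: w)) (hq : q ∈ U) (h : ∃ z, G.E q z) (W : N → ℝ≥0∞) :
    ∑' z, (pure hU f hf).prob (q :: w) z * W z = W (f (q :: w)) := by
  have prob_eq (z : N) : (pure hU f hf).prob (q :: w) z = PMF.pure (f (q :: w)) z := by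
    have : G.IsRun (q :: w) ∧ ∃ y w', q :: w = y :: w' ∧ y ∈ U ∧ ∃ z, G.E y z :=
      ⟨hw, q, w, rfl, hq, h⟩
    simp only [prob, pure, if_pos this]
  rw [tsum_eq_single (f (q :: w)), prob_eq, PMF.pure_apply_self, one_mul]
  exact fun z hz => by rw [prob_eq, PMF.pure_apply_of_ne _ _ hz, zero_mul]

theorem exists_guarantees (hG : G.FinitelyBranching) (hU : U ⊆ G.V1 ∪ G.V2) (o : Objective)
    (W : List N → N → ℝ≥0∞) :
    ∃ φ : G.Strategy U, φ.GuaranteesLE o W ∧ φ.GuaranteesGE o W := by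
  have optimal_move (w : List N) : ∃ z, ∀ q w', w = q :: w' → (∃ z, G.E q z) →
      G.E q z ∧ W w z = o.best {z | G.E q z} (W w) := by
    rcases w with _ | ⟨q, w⟩
    · exact ⟨G.s0, by simp⟩
    by_cases h : ∃ z, G.E q z
    · obtain ⟨z, hz, hbest⟩ := Objective.exists_eq_best (hG q) h o (W (q :: w))
      exact ⟨z, by rintro _ _ ⟨⟩ _; exact ⟨hz, hbest⟩⟩
    · exact ⟨q, by rintro _ _ ⟨⟩ hsucc; exact absurd hsucc h⟩
  choose f hf using optimal_move
  let φ : G.Strategy U := pure hU f fun q w _ h => (hf (q :: w) q w rfl h).1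
  have expectation_eq (q : N) (w : List N) (hw : G.IsRun (q :: w)) (hq : q ∈ U) :
      ∑' z, φ.prob (q :: w) z * W (q :: w) z = o.best {z | G.E q z} (W (q :: w)) := by
    by_cases h : ∃ z, G.E q z
    · rw [tsum_prob_pure_mul hU f _ hw hq h, (hf _ q w rfl h).2]
    · rw [φ.tsum_prob_mul_eq_zero hU hq h,
        show {z | G.E q z} = ∅ from Set.not_nonempty_iff_eq_empty.1 h, Objective.best_empty]
  exact ⟨φ, fun q w hw hq => (expectation_eq q w hw hq).le,
    fun q w hw hq => (expectation_eq q w hw hq).ge⟩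

end Strategy

end Strategies

section ValueIteration

/-- The Bellman operator for reaching `T` when the players pursue the objectives `o₁` and `o₂`. -/
noncomputable def bellman (G : StochasticGame N) (o₁ o₂ : Objective) (T : Set N) (W : N → ℝ≥0∞)
    (q : N) : ℝ≥0∞ :=
  open Classical in
  if q ∈ T then 1
  else if q ∈ G.V1 then o₁.best {z | G.E q z} W
  else if q ∈ G.V2 then o₂.best {z | G.E q z} W
  else if q ∈ G.Vp then ∑' z, G.δ q z * W z
  else 0

/-- Value iteration: the value of the game that is won by reaching `T` in fewer than `n` steps. -/
noncomputable def valueWithin (G : StochasticGame N) (o₁ o₂ : Objective) (T : Set N) :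
    ℕ → N → ℝ≥0∞
  | 0 => 0
  | n + 1 => G.bellman o₁ o₂ T (valueWithin G o₁ o₂ T n)

/-- The value of the reachability game for `T` that starts at a given node, as the limit of value
iteration. -/
noncomputable def value (G : StochasticGame N) (o₁ o₂ : Objective) (T : Set N) (q : N) : ℝ≥0∞ :=
  ⨆ n, G.valueWithin o₁ o₂ T n q

variable {o₁ o₂ : Objective} {T : Set N}

theorem bellman_of_mem {q : N} (hq : q ∈ T) (W : N → ℝ≥0∞) : G.bellman o₁ o₂ T W q = 1 :=
  if_pos hq

theorem valueWithin_succ_of_mem {q : N} (hq : q ∈ T) (n : ℕ) :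
    G.valueWithin o₁ o₂ T (n + 1) q = 1 :=
  bellman_of_mem hq _

theorem valueWithin_succ_of_mem_V1 {q : N} (hT : q ∉ T) (hq : q ∈ G.V1) (n : ℕ) :
    G.valueWithin o₁ o₂ T (n + 1) q = o₁.best {z | G.E q z} (G.valueWithin o₁ o₂ T n) := by
  rw [valueWithin, bellman, if_neg hT, if_pos hq]

theorem valueWithin_succ_of_mem_V2 {q : N} (hT : q ∉ T) (hq : q ∈ G.V2) (n : ℕ) :
    G.valueWithin o₁ o₂ T (n + 1) q = o₂.best {z | G.E q z} (G.valueWithin o₁ o₂ T n) := by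
  rw [valueWithin, bellman, if_neg hT, if_neg (G.disjoint12.notMem_of_mem_right hq), if_pos hq]

theorem valueWithin_succ_of_mem_Vp {q : N} (hT : q ∉ T) (hq : q ∈ G.Vp) (n : ℕ) :
    G.valueWithin o₁ o₂ T (n + 1) q = ∑' z, G.δ q z * G.valueWithin o₁ o₂ T n z := by
  rw [valueWithin, bellman, if_neg hT, if_neg (G.disjoint1p.notMem_of_mem_right hq),
    if_neg (G.disjoint2p.notMem_of_mem_right hq), if_pos hq]

theorem valueWithin_min_le_of_edge_V1 {q z : N} (hT : q ∉ T) (hq : q ∈ G.V1) (hE : G.E q z)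
    (n : ℕ) : G.valueWithin .min o₂ T (n + 1) q ≤ G.valueWithin .min o₂ T n z := by
  rw [valueWithin_succ_of_mem_V1 hT hq]
  exact Objective.best_min_le hE

theorem le_valueWithin_max_of_edge_V1 {q z : N} (hT : q ∉ T) (hq : q ∈ G.V1) (hE : G.E q z)
    (n : ℕ) : G.valueWithin .max o₂ T n z ≤ G.valueWithin .max o₂ T (n + 1) q := by
  rw [valueWithin_succ_of_mem_V1 hT hq]
  exact Objective.le_best_max hE

theorem valueWithin_min_le_of_edge_V2 {q z : N} (hT : q ∉ T) (hq : q ∈ G.V2) (hE : G.E q z)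
    (n : ℕ) : G.valueWithin o₁ .min T (n + 1) q ≤ G.valueWithin o₁ .min T n z := by
  rw [valueWithin_succ_of_mem_V2 hT hq]
  exact Objective.best_min_le hE

theorem le_valueWithin_max_of_edge_V2 {q z : N} (hT : q ∉ T) (hq : q ∈ G.V2) (hE : G.E q z)
    (n : ℕ) : G.valueWithin o₁ .max T n z ≤ G.valueWithin o₁ .max T (n + 1) q := by
  rw [valueWithin_succ_of_mem_V2 hT hq]
  exact Objective.le_best_max hE

theorem bellman_mono : Monotone (G.bellman o₁ o₂ T) := by
  intro V W h q
  simp only [bellman]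
  split_ifs
  · exact le_rfl
  · exact Objective.best_mono h
  · exact Objective.best_mono h
  · exact ENNReal.tsum_le_tsum fun z => mul_le_mul_right (h z) _
  · exact le_rfl

theorem bellman_le_one {W : N → ℝ≥0∞} (h : ∀ z, W z ≤ 1) (q : N) : G.bellman o₁ o₂ T W q ≤ 1 := by
  unfold bellman
  split_ifs
  · exact le_rfl
  · exact Objective.best_le_one h
  · exact Objective.best_le_one h
  · calc ∑' z, G.δ q z * W z ≤ ∑' z, G.δ q z :=
          ENNReal.tsum_le_tsum fun z => mul_le_of_le_one_right' (h z)
      _ = 1 := (G.δ q).tsum_coe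
  · exact zero_le_one

theorem bellman_iSup (hG : G.FinitelyBranching) {v : ℕ → N → ℝ≥0∞} (hv : Monotone v) (q : N) :
    G.bellman o₁ o₂ T (fun z => ⨆ n, v n z) q = ⨆ n, G.bellman o₁ o₂ T (v n) q := by
  simp only [bellman]
  split_ifs with _ _ _ hq
  · exact ciSup_const.symm
  · exact Objective.best_iSup (hG q) hv
  · exact Objective.best_iSup (hG q) hv
  · exact tsum_mul_iSup_of_monotone (G.δ_finite q hq) hv
  · exact ciSup_const.symm

theorem valueWithin_mono : Monotone (G.valueWithin o₁ o₂ T) :=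
  monotone_nat_of_le_succ fun n => by
    induction n with
    | zero => exact fun _ => zero_le
    | succ n ih => exact bellman_mono ih

theorem valueWithin_le_one (n : ℕ) (q : N) : G.valueWithin o₁ o₂ T n q ≤ 1 := by
  induction n generalizing q with
  | zero => exact zero_le_one
  | succ n ih => exact bellman_le_one ih q

theorem value_le_value {N' : Type*} {G' : StochasticGame N'} {o₁' o₂' : Objective} {T' : Set N'}
    {q : N} {q' : N'} {k l : ℕ} (hk : 0 < k)
    (h : ∀ n, G.valueWithin o₁ o₂ T (k * n) q ≤ G'.valueWithin o₁' o₂' T' (l * n) q') :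
    G.value o₁ o₂ T q ≤ G'.value o₁' o₂' T' q' :=
  iSup_le fun n =>
    calc G.valueWithin o₁ o₂ T n q
        ≤ G.valueWithin o₁ o₂ T (k * n) q := valueWithin_mono (Nat.le_mul_of_pos_left n hk) q
      _ ≤ G'.valueWithin o₁' o₂' T' (l * n) q' := h n
      _ ≤ G'.value o₁' o₂' T' q' := le_iSup (fun n => G'.valueWithin o₁' o₂' T' n q') _

theorem bellman_value (hG : G.FinitelyBranching) (q : N) :
    G.bellman o₁ o₂ T (G.value o₁ o₂ T) q = G.value o₁ o₂ T q :=
  (bellman_iSup hG valueWithin_mono q).trans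
    (Monotone.iSup_nat_add (fun _ _ h => valueWithin_mono h q) 1)

variable {φ₁ : G.Strategy G.V1} {φ₂ : G.Strategy G.V2}

theorem tsum_transProb_mul_mono {q : N} {w : List N} (hw : G.IsRun (q :: w)) {f g : N → ℝ≥0∞}
    (h : ∀ z, G.IsRun (z :: q :: w) → f z ≤ g z) :
    ∑' z, transProb φ₁ φ₂ (q :: w) z * f z ≤ ∑' z, transProb φ₁ φ₂ (q :: w) z * g z := by
  refine ENNReal.tsum_le_tsum fun z => ?_
  by_cases hz : transProb φ₁ φ₂ (q :: w) z = 0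
  · simp [hz]
  · exact mul_le_mul_right (h z (isRun_of_transProb_ne_zero hw hz)) _

theorem tsum_transProb_mul_le_bellman {W : List N → N → ℝ≥0∞} (h₁ : φ₁.GuaranteesLE o₁ W)
    (h₂ : φ₂.GuaranteesLE o₂ W) {q : N} (hq : q ∉ T) {w : List N} (hw : G.IsRun (q :: w)) :
    ∑' z, transProb φ₁ φ₂ (q :: w) z * W (q :: w) z ≤ G.bellman o₁ o₂ T (W (q :: w)) q := by
  simp only [transProb, bellman, if_neg hq]
  split_ifs with hV1 hV2
  · exact h₁ q w hw hV1
  · exact h₂ q w hw hV2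
  · exact le_rfl
  · simp

theorem bellman_le_tsum_transProb_mul {W : List N → N → ℝ≥0∞} (h₁ : φ₁.GuaranteesGE o₁ W)
    (h₂ : φ₂.GuaranteesGE o₂ W) {q : N} (hq : q ∉ T) {w : List N} (hw : G.IsRun (q :: w)) :
    G.bellman o₁ o₂ T (W (q :: w)) q ≤ ∑' z, transProb φ₁ φ₂ (q :: w) z * W (q :: w) z := by
  simp only [transProb, bellman, if_neg hq]
  split_ifs with hV1 hV2
  · exact h₁ q w hw hV1
  · exact h₂ q w hw hV2
  · exact le_rfl
  · exact zero_le

theorem reach_le_value (hG : G.FinitelyBranching)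
    (h₁ : φ₁.GuaranteesLE o₁ fun _ => G.value o₁ o₂ T)
    (h₂ : φ₂.GuaranteesLE o₂ fun _ => G.value o₁ o₂ T) :
    G.reach φ₁ φ₂ T ≤ G.value o₁ o₂ T G.s0 := by
  have reachWithin_le (n : ℕ) : ∀ q w, G.IsRun (q :: w) →
      reachWithin φ₁ φ₂ T n (q :: w) ≤ G.value o₁ o₂ T q := by
    induction n with
    | zero => exact fun _ _ _ => zero_le
    | succ n ih =>
      intro q w hw
      rw [← bellman_value hG]
      by_cases hq : q ∈ T
      · rw [reachWithin_succ_of_mem _ _ hq, bellman_of_mem hq]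
      · rw [reachWithin_succ_of_notMem _ _ hq]
        exact (tsum_transProb_mul_mono hw fun z hz => ih z _ hz).trans
          (tsum_transProb_mul_le_bellman h₁ h₂ hq hw)
  rw [reach_eq_iSup_reachWithin]
  exact iSup_le fun n => reachWithin_le n _ _ .start

-- The strategies may use the length of the run to tell how many of the `n` steps are left.
theorem valueWithin_le_reach (n : ℕ)
    (h₁ : φ₁.GuaranteesGE o₁ fun w => G.valueWithin o₁ o₂ T (n - w.length))
    (h₂ : φ₂.GuaranteesGE o₂ fun w => G.valueWithin o₁ o₂ T (n - w.length)) :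
    G.valueWithin o₁ o₂ T n G.s0 ≤ G.reach φ₁ φ₂ T := by
  have le_reachWithin (m : ℕ) : ∀ q w, G.IsRun (q :: w) → m + w.length = n →
      G.valueWithin o₁ o₂ T m q ≤ reachWithin φ₁ φ₂ T m (q :: w) := by
    induction m with
    | zero => exact fun _ _ _ _ => zero_le
    | succ m ih =>
      intro q w hw hn
      by_cases hq : q ∈ T
      · rw [reachWithin_succ_of_mem _ _ hq]
        exact valueWithin_le_one _ _
      · rw [reachWithin_succ_of_notMem _ _ hq, valueWithin]
        obtain rfl : n - (q :: w).length = m := by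
          rw [List.length_cons]
          omega
        refine (bellman_le_tsum_transProb_mul h₁ h₂ hq hw).trans
          (tsum_transProb_mul_mono hw fun z hz => ih z _ hz ?_)
        simp only [List.length_cons] at hn ⊢
        omega
  rw [reach_eq_iSup_reachWithin]
  exact (le_reachWithin n _ _ .start rfl).trans (le_iSup_of_le n le_rfl)

theorem reachPP_eq_value (hG : G.FinitelyBranching) (T : Set N) :
    G.reachPP T = G.value .max .max T G.s0 := by
  refine le_antisymm (iSup₂_le fun φ₁ φ₂ => reach_le_value hG
    (φ₁.guaranteesLE_max Set.subset_union_left _) (φ₂.guaranteesLE_max Set.subset_union_right _))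
    (iSup_le fun n => ?_)
  obtain ⟨φ₁, -, h₁⟩ := Strategy.exists_guarantees hG Set.subset_union_left .max _
  obtain ⟨φ₂, -, h₂⟩ := Strategy.exists_guarantees hG Set.subset_union_right .max _
  exact (valueWithin_le_reach n h₁ h₂).trans (le_iSup₂ (f := fun φ₁ φ₂ => G.reach φ₁ φ₂ T) φ₁ φ₂)

theorem reachPM_eq_value (hG : G.FinitelyBranching) (T : Set N) :
    G.reachPM T = G.value .max .min T G.s0 := by
  refine le_antisymm (iSup_le fun φ₁ => ?_) (iSup_le fun n => ?_)
  · obtain ⟨φ₂, h₂, -⟩ := Strategy.exists_guarantees hG Set.subset_union_right .min _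
    exact iInf_le_of_le φ₂
      (reach_le_value hG (φ₁.guaranteesLE_max Set.subset_union_left _) h₂)
  · obtain ⟨φ₁, -, h₁⟩ := Strategy.exists_guarantees hG Set.subset_union_left .max _
    exact le_iSup_of_le φ₁ (le_iInf fun φ₂ =>
      valueWithin_le_reach n h₁ (φ₂.guaranteesGE_min Set.subset_union_right _))

theorem reachMP_eq_value (hG : G.FinitelyBranching) (T : Set N) :
    G.reachMP T = G.value .min .max T G.s0 := by
  refine le_antisymm ?_ (le_iInf fun φ₁ => iSup_le fun n => ?_)
  · obtain ⟨φ₁, h₁, -⟩ := Strategy.exists_guarantees hG Set.subset_union_left .min _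
    exact iInf_le_of_le φ₁ (iSup_le fun φ₂ =>
      reach_le_value hG h₁ (φ₂.guaranteesLE_max Set.subset_union_right _))
  · obtain ⟨φ₂, -, h₂⟩ := Strategy.exists_guarantees hG Set.subset_union_right .max _
    exact le_iSup_of_le φ₂
      (valueWithin_le_reach n (φ₁.guaranteesGE_min Set.subset_union_left _) h₂)

theorem reachMM_eq_value (hG : G.FinitelyBranching) (T : Set N) :
    G.reachMM T = G.value .min .min T G.s0 := by
  refine le_antisymm ?_ (le_iInf₂ fun φ₁ φ₂ => iSup_le fun n => valueWithin_le_reach n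
    (φ₁.guaranteesGE_min Set.subset_union_left _) (φ₂.guaranteesGE_min Set.subset_union_right _))
  obtain ⟨φ₁, h₁, -⟩ := Strategy.exists_guarantees hG Set.subset_union_left .min _
  obtain ⟨φ₂, h₂, -⟩ := Strategy.exists_guarantees hG Set.subset_union_right .min _
  exact iInf₂_le_of_le φ₁ φ₂ (reach_le_value hG h₁ h₂)

end ValueIteration

end StochasticGame

namespace Transition

variable {S : Type*}

theorem IsGuard.apply_eq {g : Transition S} (hg : g.IsGuard) (M : Set S) :
    g M = {σ ∈ M | Enables σ g} := by
  rw [← g.iUnion_eq]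
  ext τ
  simp only [Set.mem_iUnion, exists_prop]
  constructor
  · rintro ⟨σ, hσ, hτ⟩
    rcases hg σ with h | h
    · obtain rfl : τ = σ := by rwa [h] at hτ
      exact ⟨hσ, h⟩
    · simp [h] at hτ
  · rintro ⟨hτ, h⟩
    exact ⟨τ, hτ, h.symm ▸ rfl⟩

theorem IsAssignment.sem_mem {c : Transition S} (hc : c.IsAssignment) {M : Set S} {σ : S}
    (hσ : σ ∈ M) : hc.sem σ ∈ c M := by
  rw [← c.iUnion_eq]
  exact Set.mem_biUnion hσ (hc.sem_spec σ ▸ rfl)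

end Transition

namespace NPP

variable {𝒱 : Type u} {rng : 𝒱 → Type v} {ι : Type w} {P : NPP rng ι} {F : Set (Config rng)}
  {o₁ o₂ : Objective}

open StochasticGame

theorem finitelyBranching_mdp [Finite ι] (P : NPP rng ι) : P.mdp.FinitelyBranching := by
  rintro (σ | a)
  · refine (Set.finite_range fun A => Sum.inr (σ, A)).subset ?_
    rintro _ ⟨_, A, ⟨⟩, rfl, _⟩
    exact ⟨A, rfl⟩
  · refine Set.finite_empty.subset ?_
    rintro _ ⟨_, _, ⟨⟩, _⟩

theorem isRun_mdp_sem {σ : Config rng} {r : List (Config rng ⊕ Config rng × ι)}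
    (hr : P.mdp.IsRun (.inl σ :: r)) {A : ι} (hA : Transition.Enables σ (P.cmd A).guard)
    {j : Fin (P.cmd A).m} (hj : (P.cmd A).p j ≠ 0) :
    P.mdp.IsRun (.inl (((P.cmd A).isAssignment j).sem σ) :: .inr (σ, A) :: .inl σ :: r) := by
  refine .random (.player hr (.inl ⟨σ, rfl⟩) ⟨σ, A, rfl, rfl, hA⟩) ⟨(σ, A), rfl⟩ ?_
  exact pos_iff_ne_zero.2 ((PMF.mem_support_map_iff _ _ _).2 ⟨j, hj, rfl⟩)

theorem valueWithin_succ_of_mem {σ : Config rng} (hσ : σ ∈ F) (n : ℕ) :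
    P.mdp.valueWithin o₁ o₂ (.inl '' F) (n + 1) (.inl σ) = 1 :=
  StochasticGame.valueWithin_succ_of_mem (Set.mem_image_of_mem _ hσ) n

theorem valueWithin_succ_of_notMem {σ : Config rng} (hσ : σ ∉ F) (n : ℕ) :
    P.mdp.valueWithin o₁ o₂ (.inl '' F) (n + 1) (.inl σ) =
      o₁.best {z | P.mdp.E (.inl σ) z} (P.mdp.valueWithin o₁ o₂ (.inl '' F) n) :=
  valueWithin_succ_of_mem_V1 (G := P.mdp) (by simpa using hσ) (Set.mem_range_self σ) n

theorem valueWithin_succ_command (σ : Config rng) (A : ι) (n : ℕ) :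
    P.mdp.valueWithin o₁ o₂ (.inl '' F) (n + 1) (.inr (σ, A)) =
      ∑' j, (P.cmd A).p j * P.mdp.valueWithin o₁ o₂ (.inl '' F) n
        (.inl (((P.cmd A).isAssignment j).sem σ)) := by
  rw [valueWithin_succ_of_mem_Vp (G := P.mdp) (by simp) (Set.mem_range_self (σ, A))]
  exact tsum_pmf_map_mul _ _ _

theorem valueWithin_min_le {σ : Config rng} (hσ : σ ∉ F) {A : ι}
    (hA : Transition.Enables σ (P.cmd A).guard) (n : ℕ) :
    P.mdp.valueWithin .min o₂ (.inl '' F) (n + 1) (.inl σ) ≤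
      P.mdp.valueWithin .min o₂ (.inl '' F) n (.inr (σ, A)) := by
  rw [valueWithin_succ_of_notMem hσ]
  exact Objective.best_min_le ⟨σ, A, rfl, rfl, hA⟩

theorem le_valueWithin_max {σ : Config rng} (hσ : σ ∉ F) {A : ι}
    (hA : Transition.Enables σ (P.cmd A).guard) (n : ℕ) :
    P.mdp.valueWithin .max o₂ (.inl '' F) n (.inr (σ, A)) ≤
      P.mdp.valueWithin .max o₂ (.inl '' F) (n + 1) (.inl σ) := by
  rw [valueWithin_succ_of_notMem hσ]
  exact Objective.le_best_max ⟨σ, A, rfl, rfl, hA⟩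

theorem le_valueWithin_min {σ : Config rng} (hσ : σ ∉ F)
    (hne : ∃ A, Transition.Enables σ (P.cmd A).guard) {n : ℕ} {c : ℝ≥0∞}
    (h : ∀ A, Transition.Enables σ (P.cmd A).guard →
      c ≤ P.mdp.valueWithin .min o₂ (.inl '' F) n (.inr (σ, A))) :
    c ≤ P.mdp.valueWithin .min o₂ (.inl '' F) (n + 1) (.inl σ) := by
  rw [valueWithin_succ_of_notMem hσ]
  obtain ⟨A, hA⟩ := hne
  refine Objective.le_best_min ⟨_, σ, A, rfl, rfl, hA⟩ ?_
  rintro _ ⟨_, A, ⟨⟩, rfl, hA⟩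
  exact h A hA

theorem valueWithin_max_le {σ : Config rng} (hσ : σ ∉ F) {n : ℕ} {c : ℝ≥0∞}
    (h : ∀ A, Transition.Enables σ (P.cmd A).guard →
      P.mdp.valueWithin .max o₂ (.inl '' F) n (.inr (σ, A)) ≤ c) :
    P.mdp.valueWithin .max o₂ (.inl '' F) (n + 1) (.inl σ) ≤ c := by
  rw [valueWithin_succ_of_notMem hσ]
  refine Objective.best_max_le ?_
  rintro _ ⟨_, A, ⟨⟩, rfl, hA⟩
  exact h A hA

theorem valueWithin_eq_zero_of_stuck {σ : Config rng} (hσ : σ ∉ F)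
    (h : ¬ ∃ A, Transition.Enables σ (P.cmd A).guard) (n : ℕ) :
    P.mdp.valueWithin o₁ o₂ (.inl '' F) (n + 1) (.inl σ) = 0 := by
  rw [valueWithin_succ_of_notMem hσ, ← o₁.best_empty]
  congr 1
  refine Set.eq_empty_iff_forall_notMem.2 ?_
  rintro _ ⟨_, A, ⟨⟩, rfl, hA⟩
  exact h ⟨A, hA⟩

end NPP

namespace IsValidAbstraction

open AbsNode StochasticGame

variable {𝒱 : Type u} {rng : 𝒱 → Type v} {ι : Type w} {D : Type x} [CompleteLattice D]
  {P : NPP rng ι} {F : Set (Config rng)} {α : Set (Config rng) → D} {γ : D → Set (Config rng)}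
  {G : StochasticGame (AbsNode P D)} {s : D} {A : ι} {σ : Config rng}

theorem finitelyBranching (hG : IsValidAbstraction P F α γ G) : G.FinitelyBranching :=
  fun _ => hG.finite.subset fun _ h => G.E_target h

theorem propose_mem_V2 (hG : IsValidAbstraction P F α γ G) {n : AbsNode P D}
    (h : G.E n (propose s A)) : propose s A ∈ G.V2 := by
  rcases G.E_target h with (h | h) | h
  · simpa using hG.V1_form _ h
  · exact h
  · simpa using hG.Vp_form _ h

theorem proposeEnd_mem_V2 (hG : IsValidAbstraction P F α γ G) {n : AbsNode P D}
    (h : G.E n (proposeEnd s)) : proposeEnd s ∈ G.V2 := by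
  rcases G.E_target h with (h | h) | h
  · simpa using hG.V1_form _ h
  · exact h
  · simpa using hG.Vp_form _ h

theorem resolve_mem_Vp (hG : IsValidAbstraction P F α γ G) {n : AbsNode P D} {s' : D}
    {d : Fin (P.cmd A).m → D} (h : G.E n (resolve s A s' d)) : resolve s A s' d ∈ G.Vp := by
  rcases G.E_target h with (h | h) | h
  · simpa using hG.V1_form _ h
  · simpa using hG.V2_form _ h
  · exact h

theorem edge_propose (hG : IsValidAbstraction P F α γ G) (hs : state s ∈ G.V1) (hσ : σ ∈ γ s)
    (hF : σ ∉ F) (hA : Transition.Enables σ (P.cmd A).guard) : G.E (state s) (propose s A) := by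
  rw [hG.state_propose_iff s A hs, (P.cmd A).isGuard.apply_eq]
  exact ⟨⟨σ, hσ, hA⟩, fun h => hF (h hσ)⟩

theorem edge_cross (hG : IsValidAbstraction P F α γ G) (h : propose s A ∈ G.V2) (hσ : σ ∈ γ s)
    (hA : ¬ Transition.Enables σ (P.cmd A).guard) : G.E (propose s A) cross := by
  refine hG.propose_cross s A h fun h => hA ?_
  rw [(P.cmd A).isGuard.apply_eq] at h
  rw [← h] at hσ
  exact hσ.2

theorem exists_accept (hG : IsValidAbstraction P F α γ G) (h : propose s A ∈ G.V2)
    (hσ : σ ∈ γ s) (hA : Transition.Enables σ (P.cmd A).guard) :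
    ∃ s' d, G.E (propose s A) (resolve s A s' d) ∧
      ∀ j, state (d j) ∈ G.V1 ∧ ((P.cmd A).isAssignment j).sem σ ∈ γ (d j) := by
  have hguard : σ ∈ (P.cmd A).guard (γ s) := by
    rw [(P.cmd A).isGuard.apply_eq]
    exact ⟨hσ, hA⟩
  obtain ⟨s', ⟨d, hE⟩, hσ'⟩ := Set.mem_iUnion₂.1 (hG.propose_accept s A h hguard)
  obtain ⟨_, _, _, _, ⟨⟩, -, -, -, hd⟩ := hG.Vp_form _ (hG.resolve_mem_Vp hE)
  exact ⟨s', d, hE, fun j =>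
    ⟨(hd j).1, (hd j).2 (((P.cmd A).isAssignment j).sem_mem hσ')⟩⟩

section Values

variable {T : Set (AbsNode P D)} {o₁ o₂ o₁' o₂' : Objective}

theorem valueWithin_succ_resolve (hG : IsValidAbstraction P F α γ G) (hT : T ⊆ {circle, cross})
    {s' : D} {d : Fin (P.cmd A).m → D} (h : resolve s A s' d ∈ G.Vp) (n : ℕ) :
    G.valueWithin o₁ o₂ T (n + 1) (resolve s A s' d) =
      ∑' j, (P.cmd A).p j * G.valueWithin o₁ o₂ T n (state (d j)) := by
  rw [valueWithin_succ_of_mem_Vp (fun h => by simpa using hT h) h, hG.δ_eq s A s' d h,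
    tsum_pmf_map_mul]

theorem valueWithin_propose_le (hG : IsValidAbstraction P F α γ G) (hT : T ⊆ {circle, cross})
    (h : propose s A ∈ G.V2) (hσ : σ ∈ γ s) (hA : Transition.Enables σ (P.cmd A).guard) {k l : ℕ}
    (hv : ∀ (j : Fin (P.cmd A).m) (s' : D), (P.cmd A).p j ≠ 0 → state s' ∈ G.V1 →
      ((P.cmd A).isAssignment j).sem σ ∈ γ s' →
      G.valueWithin o₁ .min T k (state s') ≤
        P.mdp.valueWithin o₁' o₂' (.inl '' F) l (.inl (((P.cmd A).isAssignment j).sem σ))) :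
    G.valueWithin o₁ .min T (k + 2) (propose s A) ≤
      P.mdp.valueWithin o₁' o₂' (.inl '' F) (l + 1) (.inr (σ, A)) := by
  obtain ⟨s', d, hE, hd⟩ := hG.exists_accept h hσ hA
  refine (valueWithin_min_le_of_edge_V2 (fun h => by simpa using hT h) h hE _).trans ?_
  rw [hG.valueWithin_succ_resolve hT (hG.resolve_mem_Vp hE), NPP.valueWithin_succ_command]
  refine ENNReal.tsum_le_tsum fun j => ?_
  by_cases hj : (P.cmd A).p j = 0
  · simp [hj]
  · exact mul_le_mul_right (hv j _ hj (hd j).1 (hd j).2) _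

theorem le_valueWithin_propose (hG : IsValidAbstraction P F α γ G) (hT : T ⊆ {circle, cross})
    (h : propose s A ∈ G.V2) (hσ : σ ∈ γ s) (hA : Transition.Enables σ (P.cmd A).guard) {k l : ℕ}
    (hv : ∀ (j : Fin (P.cmd A).m) (s' : D), state s' ∈ G.V1 →
      ((P.cmd A).isAssignment j).sem σ ∈ γ s' →
      P.mdp.valueWithin o₁' o₂' (.inl '' F) l (.inl (((P.cmd A).isAssignment j).sem σ)) ≤
        G.valueWithin o₁ .max T k (state s')) :
    P.mdp.valueWithin o₁' o₂' (.inl '' F) (l + 1) (.inr (σ, A)) ≤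
      G.valueWithin o₁ .max T (k + 2) (propose s A) := by
  obtain ⟨s', d, hE, hd⟩ := hG.exists_accept h hσ hA
  refine le_trans ?_ (le_valueWithin_max_of_edge_V2 (fun h => by simpa using hT h) h hE _)
  rw [hG.valueWithin_succ_resolve hT (hG.resolve_mem_Vp hE), NPP.valueWithin_succ_command]
  exact ENNReal.tsum_le_tsum fun j => mul_le_mul_right (hv j _ (hd j).1 (hd j).2) _

theorem valueWithin_cross (hG : IsValidAbstraction P F α γ G) (n : ℕ) :
    G.valueWithin o₁ o₂ {circle} n cross = 0 := by
  cases n with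
  | zero => rfl
  | succ n =>
    rw [valueWithin_succ_of_mem_V1 (by simp) hG.cross_mem, ← o₁.best_empty]
    congr 1
    exact Set.eq_empty_iff_forall_notMem.2 hG.cross_dead

-- Player 2 stays at `⟨s, ○⟩` forever.
theorem valueWithin_proposeEnd_eq_zero (hG : IsValidAbstraction P F α γ G)
    (hs : state s ∈ G.V1) (hne : (γ s ∩ F).Nonempty) (hF : ¬ γ s ⊆ F) (n : ℕ) :
    G.valueWithin o₁ .min {circle} n (proposeEnd s) = 0 := by
  have stay := hG.end_reject s hs hne hF
  induction n with
  | zero => rfl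
  | succ n ih =>
    rw [← nonpos_iff_eq_zero, ← ih]
    exact valueWithin_min_le_of_edge_V2 (by simp) (hG.proposeEnd_mem_V2 stay) stay n

theorem valueWithin_proposeEnd_eq_one (hG : IsValidAbstraction P F α γ G)
    (hT : T ⊆ {circle, cross}) (hcircle : circle ∈ T) (hs : state s ∈ G.V1)
    (hne : (γ s ∩ F).Nonempty) (n : ℕ) :
    G.valueWithin o₁ .max T (n + 2) (proposeEnd s) = 1 := by
  have hV2 := hG.proposeEnd_mem_V2 ((hG.state_end_iff s hs).2 hne)
  refine (valueWithin_le_one _ _).antisymm ?_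
  rw [← StochasticGame.valueWithin_succ_of_mem hcircle n]
  exact le_valueWithin_max_of_edge_V2 (fun h => by simpa using hT h) hV2
    (hG.end_accept s hs hne) _

theorem valueWithin_propose_eq_one (hG : IsValidAbstraction P F α γ G)
    (h : propose s A ∈ G.V2) (hσ : σ ∈ γ s)
    (hreject : σ ∈ F ∨ ¬ Transition.Enables σ (P.cmd A).guard) (n : ℕ) :
    G.valueWithin o₁ .max {circle, cross} (n + 2) (propose s A) = 1 := by
  obtain ⟨z, hz, hE⟩ : ∃ z ∈ ({circle, cross} : Set (AbsNode P D)), G.E (propose s A) z := by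
    rcases hreject with hF | hA
    · exact ⟨circle, by simp, hG.propose_circle s A h ⟨σ, hσ, hF⟩⟩
    · exact ⟨cross, by simp, hG.edge_cross h hσ hA⟩
  refine (valueWithin_le_one _ _).antisymm ?_
  rw [← StochasticGame.valueWithin_succ_of_mem hz n]
  exact le_valueWithin_max_of_edge_V2 (by simp) h hE _

end Values

section Simulation

/- One command is two steps of the Markov decision process (choice of the command, random update)
and three of the abstraction (proposal, choice of `⟨s, A, s', d⟩`, random update). -/

theorem valueWithin_minMin_le (hG : IsValidAbstraction P F α γ G) (hstuck : P.NeverStuck F)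
    (n : ℕ) {r : List (Config rng ⊕ Config rng × ι)} (hr : P.mdp.IsRun (.inl σ :: r))
    (hs : state s ∈ G.V1) (hσ : σ ∈ γ s) :
    G.valueWithin .min .min {circle, cross} (3 * n) (state s) ≤
      P.mdp.valueWithin .min .min (.inl '' F) (2 * n) (.inl σ) := by
  induction n generalizing σ s r with
  | zero => exact zero_le
  | succ n ih =>
    by_cases hF : σ ∈ F
    · exact (valueWithin_le_one _ _).trans_eq (NPP.valueWithin_succ_of_mem hF _).symm
    refine NPP.le_valueWithin_min hF ((hstuck r σ hr).resolve_left hF) fun A hA => ?_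
    have hE := hG.edge_propose hs hσ hF hA
    refine (valueWithin_min_le_of_edge_V1 (by simp) hs hE _).trans ?_
    exact hG.valueWithin_propose_le subset_rfl (hG.propose_mem_V2 hE) hσ hA
      fun j s' hj => ih (NPP.isRun_mdp_sem hr hA hj)

theorem le_valueWithin_minMax (hG : IsValidAbstraction P F α γ G) (n : ℕ)
    (hs : state s ∈ G.V1) (hσ : σ ∈ γ s) :
    P.mdp.valueWithin .min .min (.inl '' F) (2 * n) (.inl σ) ≤
      G.valueWithin .min .max {circle, cross} (3 * n) (state s) := by
  induction n generalizing σ s with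
  | zero => exact zero_le
  | succ n ih =>
    by_cases hdead : σ ∉ F ∧ ¬ ∃ A, Transition.Enables σ (P.cmd A).guard
    · exact (NPP.valueWithin_eq_zero_of_stuck hdead.1 hdead.2 _).trans_le zero_le
    have hsucc : ∃ z, G.E (state s) z := by
      by_cases hF : σ ∈ F
      · exact ⟨_, (hG.state_end_iff s hs).2 ⟨σ, hσ, hF⟩⟩
      · obtain ⟨A, hA⟩ := not_not.1 fun h => hdead ⟨hF, h⟩
        exact ⟨_, hG.edge_propose hs hσ hF hA⟩
    refine (Objective.le_best_min hsucc fun z hz => ?_).trans_eq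
      (valueWithin_succ_of_mem_V1 (by simp) hs (3 * n + 2)).symm
    rcases hG.state_succ s z hs hz with rfl | ⟨A, rfl⟩
    · exact (valueWithin_le_one _ _).trans_eq (hG.valueWithin_proposeEnd_eq_one subset_rfl
        (by simp) hs ((hG.state_end_iff s hs).1 hz) _).symm
    have hV2 := hG.propose_mem_V2 hz
    by_cases hreject : σ ∈ F ∨ ¬ Transition.Enables σ (P.cmd A).guard
    · exact (valueWithin_le_one _ _).trans_eq
        (hG.valueWithin_propose_eq_one hV2 hσ hreject _).symm
    obtain ⟨hF, hA⟩ : σ ∉ F ∧ Transition.Enables σ (P.cmd A).guard := by tauto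
    refine (NPP.valueWithin_min_le hF hA _).trans ?_
    exact hG.le_valueWithin_propose subset_rfl hV2 hσ hA fun j s' => ih

theorem valueWithin_maxMin_le (hG : IsValidAbstraction P F α γ G) (n : ℕ)
    (hs : state s ∈ G.V1) (hσ : σ ∈ γ s) :
    G.valueWithin .max .min {circle} (3 * n) (state s) ≤
      P.mdp.valueWithin .max .max (.inl '' F) (2 * n) (.inl σ) := by
  induction n generalizing σ s with
  | zero => exact zero_le
  | succ n ih =>
    by_cases hF : σ ∈ F
    · exact (valueWithin_le_one _ _).trans_eq (NPP.valueWithin_succ_of_mem hF _).symm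
    refine (valueWithin_succ_of_mem_V1 (by simp) hs (3 * n + 2)).trans_le
      (Objective.best_max_le fun z hz => ?_)
    rcases hG.state_succ s z hs hz with rfl | ⟨A, rfl⟩
    · exact (hG.valueWithin_proposeEnd_eq_zero hs ((hG.state_end_iff s hs).1 hz)
        (fun h => hF (h hσ)) _).trans_le zero_le
    have hV2 := hG.propose_mem_V2 hz
    by_cases hA : Transition.Enables σ (P.cmd A).guard
    · refine le_trans ?_ (NPP.le_valueWithin_max hF hA _)
      exact hG.valueWithin_propose_le (by simp) hV2 hσ hA fun j s' _ => ih
    · calc G.valueWithin .max .min {circle} (3 * n + 2) (propose s A)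
          ≤ G.valueWithin .max .min {circle} (3 * n + 1) cross := by
            rw [valueWithin_succ_of_mem_V2 (by simp) hV2]
            exact Objective.best_min_le (hG.edge_cross hV2 hσ hA)
        _ = 0 := hG.valueWithin_cross _
        _ ≤ _ := zero_le

theorem le_valueWithin_maxMax (hG : IsValidAbstraction P F α γ G) (n : ℕ)
    (hs : state s ∈ G.V1) (hσ : σ ∈ γ s) :
    P.mdp.valueWithin .max .max (.inl '' F) (2 * n) (.inl σ) ≤
      G.valueWithin .max .max {circle} (3 * n) (state s) := by
  induction n generalizing σ s with
  | zero => exact zero_le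
  | succ n ih =>
    by_cases hF : σ ∈ F
    · have hne : (γ s ∩ F).Nonempty := ⟨σ, hσ, hF⟩
      calc P.mdp.valueWithin .max .max (.inl '' F) (2 * n + 2) (.inl σ)
          ≤ 1 := valueWithin_le_one _ _
        _ = G.valueWithin .max .max {circle} (3 * n + 2) (proposeEnd s) :=
            (hG.valueWithin_proposeEnd_eq_one (by simp) (Set.mem_singleton circle) hs hne _).symm
        _ ≤ G.valueWithin .max .max {circle} (3 * n + 3) (state s) :=
            le_valueWithin_max_of_edge_V1 (by simp) hs ((hG.state_end_iff s hs).2 hne) _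
    · refine NPP.valueWithin_max_le hF fun A hA => ?_
      have hE := hG.edge_propose hs hσ hF hA
      refine le_trans ?_ (le_valueWithin_max_of_edge_V1 (by simp) hs hE _)
      exact hG.le_valueWithin_propose (by simp) (hG.propose_mem_V2 hE) hσ hA fun j s' => ih

end Simulation

end IsValidAbstraction

theorem theorem1_general {𝒱 : Type u} {rng : 𝒱 → Type v} {ι : Type w} [Finite ι]
    {D : Type x} [CompleteLattice D]
    (α : Set (Config rng) → D) (γ : D → Set (Config rng))
    (P : NPP rng ι) (hα : P.σ0 ∈ γ (α {P.σ0})) (F : Set (Config rng)) (hstuck : P.NeverStuck F)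
    (G : StochasticGame (AbsNode P D)) (hG : IsValidAbstraction P F α γ G) :
    P.minReach F ∈ Set.Icc (G.reachMM {AbsNode.circle, AbsNode.cross})
      (G.reachMP {AbsNode.circle, AbsNode.cross}) ∧
    P.maxReach F ∈ Set.Icc (G.reachPM {AbsNode.circle}) (G.reachPP {AbsNode.circle}) := by
  have hM := P.finitelyBranching_mdp
  have hG' := hG.finitelyBranching
  have hs : AbsNode.state (α {P.σ0}) ∈ G.V1 := hG.start_eq ▸ G.s0_mem
  rw [NPP.minReach, NPP.maxReach, StochasticGame.reachMM_eq_value hM,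
    StochasticGame.reachPP_eq_value hM, StochasticGame.reachMM_eq_value hG',
    StochasticGame.reachMP_eq_value hG', StochasticGame.reachPM_eq_value hG',
    StochasticGame.reachPP_eq_value hG', hG.start_eq]
  exact ⟨⟨StochasticGame.value_le_value three_pos fun n =>
        hG.valueWithin_minMin_le hstuck n .start hs hα,
      StochasticGame.value_le_value two_pos fun n => hG.le_valueWithin_minMax n hs hα⟩,
    StochasticGame.value_le_value three_pos fun n => hG.valueWithin_maxMin_le n hs hα,
    StochasticGame.value_le_value two_pos fun n => hG.le_valueWithin_maxMax n hs hα⟩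

theorem theorem1 {𝒱 : Type u} [Finite 𝒱] {rng : 𝒱 → Type v} {ι : Type w} [Finite ι]
    {D : Type x} [CompleteLattice D]
    (α : Set (Config rng) → D) (γ : D → Set (Config rng)) (hαγ : GaloisConnection α γ)
    (P : NPP rng ι) (F : Set (Config rng)) (hσ0 : P.σ0 ∉ F) (hstuck : P.NeverStuck F)
    (G : StochasticGame (AbsNode P D)) (hG : IsValidAbstraction P F α γ G) :
    P.minReach F ∈ Set.Icc (G.reachMM {AbsNode.circle, AbsNode.cross})
      (G.reachMP {AbsNode.circle, AbsNode.cross}) ∧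
    P.maxReach F ∈ Set.Icc (G.reachPM {AbsNode.circle}) (G.reachPP {AbsNode.circle}) :=
  theorem1_general α γ P (hαγ.le_u_l _ rfl) F hstuck G hG
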